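/- Let $p$ be a prime and let $n=p+i$ with $0\le i\le p-1$. Let the symmetric group $\mathfrak S_n$ act on $\mathbb F_p[x_1,\dots,x_n]$ by permuting the variables, let $e_j$ denote the $j$-th elementary symmetric polynomial in $x_1,\dots,x_n$, and let $\mathbb F_p[e_1,\dots,e_n]\subseteq\mathbb F_p[x_1,\dots,x_n]$ be the subalgebra they generate. Let $$\mathbb F_p[x_1,\dots,x_n]_{\mathfrak S_n}=\mathbb F_p[x_1,\dots,x_n]\big/\operatorname{span}_{\mathbb F_p}\{f-\sigma(f): f\in\mathbb F_p[x_1,\dots,x_n],\ \sigma\in\mathfrak S_n\}$$ be the cofixed space, which is a module over $\mathbb F_p[e_1,\dots,e_n]$ by multiplication. Then there is an isomorphism of $\mathbb F_p[e_1,\dots,e_n]$-modules $$\mathbb F_p[x_1,\dots,x_n]_{\mathfrak S_n}\;\cong\;\frac{\mathbb F_p[e_1,\dots,e_n]}{\widetilde J_n}\oplus\widetilde J_n,$$ where $\widetilde J_n$ is the ideal $$\widetilde J_n=\langle e_1e_p-e_{p+1},\ e_2e_p-e_{p+2},\ \dots,\ e_ie_p-e_{p+i},\ e_{i+1},\ e_{i+2},\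 \dots,\ e_{p-1}\rangle$$ of $\mathbb F_p[e_1,\dots,e_n]$ (generators $e_je_p-e_{p+j}$ for $1\le j\le i$, and $e_j$ for $i+1\le j\le p-1$). -/

import Mathlib

namespace SymmetricCofixed

open MvPolynomial

/-- The subalgebra `k[e₁, …, eₙ]` of `k[x₁, …, xₙ]` generated over `k` by the elementary symmetric
polynomials of degrees `1, …, n`. -/
noncomputable def elemSubalgebra (k : Type*) [CommRing k] (n : ℕ) :
    Subalgebra k (MvPolynomial (Fin n) k) :=
  Algebra.adjoin k (Set.range fun j : Fin n => esymm (Fin n) k (j + 1))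

/-- The ring `k[e₁, …, eₙ]`, as a type. -/
def ElemRing (k : Type*) [CommRing k] (n : ℕ) : Type _ :=
  elemSubalgebra k n

noncomputable instance (k : Type*) [CommRing k] (n : ℕ) : CommRing (ElemRing k n) :=
  inferInstanceAs (CommRing (elemSubalgebra k n))

/-- `k[x₁, …, xₙ]` is an algebra over its subring `k[e₁, …, eₙ]` through the inclusion. -/
noncomputable instance (k : Type*) [CommRing k] (n : ℕ) :
    Algebra (ElemRing k n) (MvPolynomial (Fin n) k) :=
  inferInstanceAs (Algebra (elemSubalgebra k n) (MvPolynomial (Fin n) k))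

theorem esymm_mem_elemSubalgebra (k : Type*) [CommRing k] (n j : ℕ) :
    esymm (Fin n) k j ∈ elemSubalgebra k n := by
  rcases Nat.eq_zero_or_pos j with rfl | hj
  · rw [esymm_zero]; exact one_mem _
  · by_cases hjn : j ≤ n
    · refine Algebra.subset_adjoin ⟨⟨j - 1, by omega⟩, ?_⟩
      simp [Nat.sub_add_cancel hj]
    · have h0 : esymm (Fin n) k j = 0 := by
        rw [esymm, Finset.powersetCard_eq_empty.2 (by simpa using hjn), Finset.sum_empty]
      rw [h0]; exact zero_mem _

theorem rename_of_mem_elemSubalgebra {k : Type*} [CommRing k] {n : ℕ} {r : MvPolynomial (Fin n) k}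
    (hr : r ∈ elemSubalgebra k n) (σ : Equiv.Perm (Fin n)) : rename σ r = r := by
  have hle : elemSubalgebra k n ≤ symmetricSubalgebra (Fin n) k := by
    refine Algebra.adjoin_le ?_
    rintro _ ⟨j, rfl⟩
    exact esymm_isSymmetric (Fin n) k _
  exact hle hr σ

/-- The elementary symmetric polynomial `e_j` as an element of `k[e₁, …, eₙ]`
(so `e_0 = 1`, and `e_j = 0` for `j > n`). -/
noncomputable def e (k : Type*) [CommRing k] (n j : ℕ) : ElemRing k n :=
  ⟨esymm (Fin n) k j, esymm_mem_elemSubalgebra k n j⟩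

/-- The `k`-linear span of all `f - σ(f)`, where `f ∈ k[x₁, …, xₙ]` and the permutation `σ` acts by
permuting the variables. It is stable under multiplication by `k[e₁, …, eₙ]`, and is recorded as a
`k[e₁, …, eₙ]`-submodule. -/
noncomputable def cofixedRelations (k : Type*) [CommRing k] (n : ℕ) :
    Submodule (ElemRing k n) (MvPolynomial (Fin n) k) where
  carrier := (Submodule.span k
    {g : MvPolynomial (Fin n) k | ∃ (f : MvPolynomial (Fin n) k) (σ : Equiv.Perm (Fin n)),
      g = f - rename σ f} : Submodule k (MvPolynomial (Fin n) k))
  add_mem' := fun ha hb => Submodule.add_mem _ ha hb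
  zero_mem' := Submodule.zero_mem _
  smul_mem' := by
    intro r g hg
    change g ∈ Submodule.span k _ at hg
    change r.1 * g ∈ Submodule.span k _
    induction hg using Submodule.span_induction with
    | mem g hg =>
      obtain ⟨f, σ, rfl⟩ := hg
      refine Submodule.subset_span ⟨r.1 * f, σ, ?_⟩
      rw [map_mul, rename_of_mem_elemSubalgebra r.2 σ, mul_sub]
    | zero => rw [mul_zero]; exact Submodule.zero_mem _
    | add a b _ _ ha hb => rw [mul_add]; exact Submodule.add_mem _ ha hb
    | smul c a _ ha => rw [mul_smul_comm]; exact Submodule.smul_mem _ c ha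

/-- The cofixed space (coinvariants) `k[x₁, …, xₙ]_{𝔖ₙ}`, a module over `k[e₁, …, eₙ]`. -/
abbrev CofixedSpace (k : Type*) [CommRing k] (n : ℕ) : Type _ :=
  MvPolynomial (Fin n) k ⧸ cofixedRelations k n

/-- The ideal of `k[e₁, …, eₙ]` generated by `e_j e_p - e_{p+j}` for `1 ≤ j ≤ i` and by `e_j` for
`i + 1 ≤ j ≤ p - 1`. -/
noncomputable def idealJ (k : Type*) [CommRing k] (n p i : ℕ) : Ideal (ElemRing k n) :=
  Ideal.span
    ({g | ∃ j : ℕ, 1 ≤ j ∧ j ≤ i ∧ g = e k n j * e k n p - e k n (p + j)} ∪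
      {g | ∃ j : ℕ, i < j ∧ j < p ∧ g = e k n j})

end SymmetricCofixed

/-!
Write `R = k[e₁, …, eₙ]`, `A = k[x₁, …, xₙ]`, `M` for the cofixed space and `J` for the ideal, with
`k = 𝔽_p`. Let `α : R → M` be `r ↦ [r]`, and let `τ : M → R` be induced by the transfer
`f ↦ ∑ σ, σ(f)`. Then `ker α = J = range τ` and `ker τ = range α`, so there is an exact sequence
`0 → R ⧸ J → M → J → 0`, and it splits.

* Both composites of `α` and `τ` are multiplication by `n! = 0`. The converse inclusions hold
  because `n! = p u` with `p ∤ u`: lift to integral coefficients, where the cofixed space is torsion-free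
  (it is free on the orbits of monomials), and divide by `p`. This gives `ker τ = range α`
  (`exists_sub_mem_of_transfer_eq_zero`) and `ker α = range τ`
  (`exists_transfer_eq_of_algebraMap_mem`).
* `J ≤ ker α` (`algebraMap_mem_of_mem_idealJ`). Fix a block `P` of `p` variables. For `0 < a < p`
  the multiples of `e_a(P)` by polynomials symmetric in `P` vanish in `M`, so in computing classes the
  generating polynomial `∏ (1 + x T)` of the `e_j` may be replaced by
  `(1 + x_P T ^ p) ∏_{y ∉ P} (1 + y T)`, where `x_P` is the product of the block. The coefficients
  of the latter satisfy the equations that generate `J`.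
* Splitting, and `ker α ≤ J`. Give the variables of a block a common value `z`, name the remaining
  ones `y₁, …, yᵢ`, and add the results over all choices of the block and of the naming
  (`blockSum`). This factors through `M`, and on the class of `r ∈ R` it is `n! / p!`, a unit, times
  the restriction of `r` to the locus where a block of variables is equal. The restriction maps `R`
  onto `k[y₁, …, yᵢ]^{𝔖ᵢ}[z ^ p]` with kernel `J`. Keeping only the powers of `z ^ p`
  (`contractSum`) thus gives an `R`-linear map from `M` to a copy of `R ⧸ J` which is surjective
  already on `range α`, and its kernel is a complement of `range α`.
-/

namespace SymmetricCofixed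

open MvPolynomial

/-! ### The ring generated by the elementary symmetric polynomials -/

section ElemRing

variable {k : Type*} [CommRing k] {n : ℕ}

noncomputable instance : Algebra k (ElemRing k n) :=
  inferInstanceAs (Algebra k (elemSubalgebra k n))

theorem algebraMap_injective :
    Function.Injective (algebraMap (ElemRing k n) (MvPolynomial (Fin n) k)) :=
  Subtype.val_injective

@[simp]
theorem algebraMap_e (j : ℕ) :
    algebraMap (ElemRing k n) (MvPolynomial (Fin n) k) (e k n j) = esymm (Fin n) k j :=
  rfl

@[simp]
theorem algebraMap_algebraMap (c : k) :
    algebraMap (ElemRing k n) (MvPolynomial (Fin n) k) (algebraMap k (ElemRing k n) c) = C c :=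
  rfl

@[elab_as_elim]
theorem ElemRing.induction {P : ElemRing k n → Prop} (hC : ∀ c : k, P (algebraMap k _ c))
    (he : ∀ j, P (e k n j)) (hadd : ∀ r s, P r → P s → P (r + s))
    (hmul : ∀ r s, P r → P s → P (r * s)) (r : ElemRing k n) : P r := by
  obtain ⟨r, hr⟩ := r
  refine Algebra.adjoin_induction (p := fun x hx => P ⟨x, hx⟩) ?_ hC
    (fun x y hx hy h1 h2 => hadd ⟨x, hx⟩ ⟨y, hy⟩ h1 h2)
    (fun x y hx hy h1 h2 => hmul ⟨x, hx⟩ ⟨y, hy⟩ h1 h2) hr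
  rintro _ ⟨j, rfl⟩
  exact he _

theorem rename_algebraMap (r : ElemRing k n) (σ : Equiv.Perm (Fin n)) :
    rename σ (algebraMap (ElemRing k n) (MvPolynomial (Fin n) k) r) =
      algebraMap (ElemRing k n) (MvPolynomial (Fin n) k) r :=
  rename_of_mem_elemSubalgebra r.2 σ

theorem exists_algebraMap_eq_of_isSymmetric {f : MvPolynomial (Fin n) k} (hf : f.IsSymmetric) :
    ∃ r : ElemRing k n, algebraMap (ElemRing k n) (MvPolynomial (Fin n) k) r = f := by
  have hf' : f ∈ elemSubalgebra k n := by
    obtain ⟨q, hq⟩ := esymmAlgHom_surjective k (σ := Fin n) (n := n) (by simp) ⟨f, hf⟩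
    have h : aeval (fun j : Fin n => esymm (Fin n) k (j + 1)) q = f := by
      rw [← esymmAlgHom_apply, hq]
    rw [elemSubalgebra, Algebra.adjoin_range_eq_range_aeval]
    exact ⟨q, h⟩
  exact ⟨⟨f, hf'⟩, rfl⟩

theorem exists_map_algebraMap_eq {l : Type*} [CommRing l] {φ : l →+* k}
    (hφ : Function.Surjective φ) (r : ElemRing k n) :
    ∃ s : ElemRing l n, map φ (algebraMap (ElemRing l n) (MvPolynomial (Fin n) l) s) =
      algebraMap (ElemRing k n) (MvPolynomial (Fin n) k) r := by
  induction r using ElemRing.induction with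
  | hC c =>
    obtain ⟨d, rfl⟩ := hφ c
    exact ⟨algebraMap l _ d, by simp⟩
  | he j => exact ⟨e l n j, by simp [map_esymm]⟩
  | hadd r s hr hs =>
    obtain ⟨r', hr⟩ := hr
    obtain ⟨s', hs⟩ := hs
    exact ⟨r' + s', by simp [hr, hs]⟩
  | hmul r s hr hs =>
    obtain ⟨r', hr⟩ := hr
    obtain ⟨s', hs⟩ := hs
    exact ⟨r' * s', by simp [hr, hs]⟩

end ElemRing

/-! ### Normal forms in the cofixed space, and the transfer -/

section Relations

variable {k : Type*} [CommRing k] {n : ℕ}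

theorem sub_rename_mem (f : MvPolynomial (Fin n) k) (σ : Equiv.Perm (Fin n)) :
    f - rename σ f ∈ cofixedRelations k n :=
  Submodule.subset_span ⟨f, σ, rfl⟩

theorem smul_mem_cofixedRelations (c : k) {f : MvPolynomial (Fin n) k}
    (hf : f ∈ cofixedRelations k n) : c • f ∈ cofixedRelations k n :=
  Submodule.smul_mem (Submodule.span k _) c hf

@[elab_as_elim]
theorem cofixedRelations_induction
    {P : ∀ f : MvPolynomial (Fin n) k, f ∈ cofixedRelations k n → Prop}
    (hsub : ∀ f (σ : Equiv.Perm (Fin n)), P (f - rename σ f) (sub_rename_mem f σ))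
    (hzero : P 0 (zero_mem _))
    (hadd : ∀ f g hf hg, P f hf → P g hg → P (f + g) (add_mem hf hg))
    (hsmul : ∀ (c : k) f hf, P f hf → P (c • f) (smul_mem_cofixedRelations c hf))
    {f : MvPolynomial (Fin n) k} (hf : f ∈ cofixedRelations k n) : P f hf := by
  change f ∈ Submodule.span k _ at hf
  induction hf using Submodule.span_induction with
  | mem g hg =>
    obtain ⟨f, σ, rfl⟩ := hg
    exact hsub f σ
  | zero => exact hzero
  | add a b h1 h2 ha hb => exact hadd a b h1 h2 ha hb
  | smul c a h ha => exact hsmul c a h ha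

theorem map_mem_cofixedRelations {l : Type*} [CommRing l] (φ : l →+* k)
    {f : MvPolynomial (Fin n) l} (hf : f ∈ cofixedRelations l n) :
    map φ f ∈ cofixedRelations k n := by
  induction hf using cofixedRelations_induction with
  | hsub f σ =>
    rw [map_sub, map_rename]
    exact sub_rename_mem _ σ
  | hzero => simp
  | hadd f g _ _ hf hg => simpa using add_mem hf hg
  | hsmul c f _ hf =>
    rw [smul_eq_C_mul, map_mul, map_C, ← smul_eq_C_mul]
    exact smul_mem_cofixedRelations _ hf

theorem exists_map_eq_of_mem_cofixedRelations {l : Type*} [CommRing l] {φ : l →+* k}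
    (hφ : Function.Surjective φ) {f : MvPolynomial (Fin n) k} (hf : f ∈ cofixedRelations k n) :
    ∃ g ∈ cofixedRelations l n, map φ g = f := by
  induction hf using cofixedRelations_induction with
  | hsub f σ =>
    obtain ⟨g, rfl⟩ := map_surjective φ hφ f
    exact ⟨g - rename σ g, sub_rename_mem g σ, by rw [map_sub, map_rename]⟩
  | hzero => exact ⟨0, zero_mem _, map_zero _⟩
  | hadd f g _ _ hf hg =>
    obtain ⟨f', hf', rfl⟩ := hf
    obtain ⟨g', hg', rfl⟩ := hg
    exact ⟨f' + g', add_mem hf' hg', map_add _ _ _⟩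
  | hsmul c f _ hf =>
    obtain ⟨f', hf', rfl⟩ := hf
    obtain ⟨d, rfl⟩ := hφ c
    exact ⟨d • f', smul_mem_cofixedRelations d hf', by simp [smul_eq_C_mul]⟩

/-- Two exponent vectors are equivalent if a permutation of the variables carries one to the
other. -/
def expSetoid (n : ℕ) : Setoid (Fin n →₀ ℕ) where
  r a b := ∃ σ : Equiv.Perm (Fin n), a.mapDomain σ = b
  iseqv :=
    { refl := fun a => ⟨1, by simp [Equiv.Perm.coe_one, Finsupp.mapDomain_id]⟩
      symm := by
        rintro a _ ⟨σ, rfl⟩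
        refine ⟨σ⁻¹, ?_⟩
        rw [← Finsupp.mapDomain_comp]
        convert Finsupp.mapDomain_id
        ext x
        simp
      trans := by
        rintro a _ _ ⟨σ, rfl⟩ ⟨τ, rfl⟩
        exact ⟨τ * σ, by rw [← Finsupp.mapDomain_comp]; rfl⟩ }

/-- A chosen representative of the orbit of an exponent vector. -/
noncomputable def expRep (a : Fin n →₀ ℕ) : Fin n →₀ ℕ :=
  (Quotient.mk (expSetoid n) a).out

theorem exists_mapDomain_eq_expRep (a : Fin n →₀ ℕ) :
    ∃ σ : Equiv.Perm (Fin n), a.mapDomain σ = expRep a :=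
  (expSetoid n).symm (Quotient.mk_out (s := expSetoid n) a)

theorem expRep_mapDomain (σ : Equiv.Perm (Fin n)) (a : Fin n →₀ ℕ) :
    expRep (a.mapDomain σ) = expRep a := by
  rw [expRep, expRep, Quotient.sound (s := expSetoid n) (a := a.mapDomain σ) (b := a)]
  exact (expSetoid n).symm ⟨σ, rfl⟩

/-- The `k`-linear map replacing every monomial by the chosen representative of its orbit. It
realises the cofixed space as a free `k`-module on the orbits of monomials. -/
noncomputable def normalForm (k : Type*) [CommRing k] (n : ℕ) :
    MvPolynomial (Fin n) k →ₗ[k] MvPolynomial (Fin n) k :=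
  (basisMonomials (Fin n) k).constr k fun a => monomial (expRep a) 1

theorem normalForm_monomial (a : Fin n →₀ ℕ) (c : k) :
    normalForm k n (monomial a c) = monomial (expRep a) c := by
  have h : monomial a c = c • basisMonomials (Fin n) k a := by simp [smul_monomial]
  rw [h, map_smul, normalForm, Module.Basis.constr_basis, smul_monomial, smul_eq_mul, mul_one]

theorem normalForm_rename (σ : Equiv.Perm (Fin n)) (f : MvPolynomial (Fin n) k) :
    normalForm k n (rename σ f) = normalForm k n f := by
  induction f using MvPolynomial.induction_on' with
  | monomial a c => rw [rename_monomial, normalForm_monomial, normalForm_monomial, expRep_mapDomain]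
  | add f g hf hg => rw [map_add, map_add, map_add, hf, hg]

theorem sub_normalForm_mem (f : MvPolynomial (Fin n) k) :
    f - normalForm k n f ∈ cofixedRelations k n := by
  induction f using MvPolynomial.induction_on' with
  | monomial a c =>
    obtain ⟨σ, hσ⟩ := exists_mapDomain_eq_expRep a
    rw [normalForm_monomial, ← hσ, ← rename_monomial]
    exact sub_rename_mem _ σ
  | add f g hf hg =>
    rw [map_add, add_sub_add_comm]
    exact add_mem hf hg

/-- The relations are the kernel of the normal form. -/
theorem mem_cofixedRelations_iff_normalForm_eq_zero {f : MvPolynomial (Fin n) k} :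
    f ∈ cofixedRelations k n ↔ normalForm k n f = 0 := by
  refine ⟨fun hf => ?_, fun hf => by simpa [hf] using sub_normalForm_mem f⟩
  induction hf using cofixedRelations_induction with
  | hsub f σ => rw [map_sub, normalForm_rename, sub_self]
  | hzero => exact map_zero _
  | hadd f g _ _ hf hg => rw [map_add, hf, hg, add_zero]
  | hsmul c f _ hf => rw [map_smul, hf, smul_zero]

/-- The cofixed space of a polynomial ring over a domain is torsion-free. -/
theorem mem_cofixedRelations_of_smul_mem [IsDomain k] {c : k} (hc : c ≠ 0)
    {f : MvPolynomial (Fin n) k} (hf : c • f ∈ cofixedRelations k n) :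
    f ∈ cofixedRelations k n := by
  rw [mem_cofixedRelations_iff_normalForm_eq_zero] at hf ⊢
  rw [map_smul] at hf
  exact (smul_eq_zero.1 hf).resolve_left hc

/-- The transfer `f ↦ ∑ σ, σ(f)`, as a `k[e₁, …, eₙ]`-linear map. -/
noncomputable def transfer (k : Type*) [CommRing k] (n : ℕ) :
    MvPolynomial (Fin n) k →ₗ[ElemRing k n] MvPolynomial (Fin n) k where
  toFun f := ∑ σ : Equiv.Perm (Fin n), rename σ f
  map_add' f g := by simp [Finset.sum_add_distrib]
  map_smul' r f := by
    simp only [Algebra.smul_def, map_mul, rename_algebraMap, Finset.mul_sum, RingHom.id_apply]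

theorem transfer_apply (f : MvPolynomial (Fin n) k) :
    transfer k n f = ∑ σ : Equiv.Perm (Fin n), rename σ f :=
  rfl

theorem isSymmetric_transfer (f : MvPolynomial (Fin n) k) : (transfer k n f).IsSymmetric := by
  intro τ
  rw [transfer_apply, map_sum]
  refine Fintype.sum_equiv (Equiv.mulLeft τ) _ _ fun σ => ?_
  rw [rename_rename]
  rfl

theorem transfer_rename (σ : Equiv.Perm (Fin n)) (f : MvPolynomial (Fin n) k) :
    transfer k n (rename σ f) = transfer k n f := by
  rw [transfer_apply, transfer_apply]
  refine Fintype.sum_equiv (Equiv.mulRight σ) _ _ fun τ => ?_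
  rw [rename_rename]
  rfl

theorem transfer_smul (c : k) (f : MvPolynomial (Fin n) k) :
    transfer k n (c • f) = c • transfer k n f := by
  simp [transfer_apply, Finset.smul_sum]

theorem transfer_of_isSymmetric {f : MvPolynomial (Fin n) k} (hf : f.IsSymmetric) :
    transfer k n f = (n.factorial : k) • f := by
  rw [transfer_apply, Finset.sum_congr rfl fun σ _ => hf σ, Finset.sum_const, Finset.card_univ,
    Fintype.card_perm, Fintype.card_fin, Nat.cast_smul_eq_nsmul]

theorem cofixedRelations_le_ker_transfer :
    cofixedRelations k n ≤ LinearMap.ker (transfer k n) := by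
  intro f hf
  rw [LinearMap.mem_ker]
  induction hf using cofixedRelations_induction with
  | hsub f σ => rw [map_sub, transfer_rename, sub_self]
  | hzero => exact map_zero _
  | hadd f g _ _ hf hg => rw [map_add, hf, hg, add_zero]
  | hsmul c f _ hf => rw [transfer_smul, hf, smul_zero]

theorem transfer_sub_factorial_smul_mem (f : MvPolynomial (Fin n) k) :
    transfer k n f - (n.factorial : k) • f ∈ cofixedRelations k n := by
  have h : transfer k n f - (n.factorial : k) • f =
      -∑ σ : Equiv.Perm (Fin n), (f - rename σ f) := by
    rw [Finset.sum_sub_distrib, Finset.sum_const, Finset.card_univ, Fintype.card_perm,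
      Fintype.card_fin, Nat.cast_smul_eq_nsmul, transfer_apply, neg_sub]
  rw [h]
  exact neg_mem (sum_mem fun σ _ => sub_rename_mem f σ)

theorem isSymmetric_of_smul {f : MvPolynomial (Fin n) k} [IsDomain k] {c : k} (hc : c ≠ 0)
    (hf : (c • f).IsSymmetric) : f.IsSymmetric := by
  intro σ
  have h := hf σ
  rw [map_smul] at h
  exact smul_right_injective _ hc h

end Relations

/-! ### Kernel and image of the transfer, by integral lifts -/

section Integral

variable {p n u : ℕ}

theorem exists_eq_smul_of_map_eq_zero {f : MvPolynomial (Fin n) ℤ}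
    (hf : map (Int.castRingHom (ZMod p)) f = 0) : ∃ g, f = (p : ℤ) • g := by
  obtain ⟨g, hg⟩ := (C_dvd_iff_zmod p f).2 hf
  exact ⟨g, by rw [hg, smul_eq_C_mul]⟩

theorem map_natCast_smul (m : ℕ) (f : MvPolynomial (Fin n) ℤ) :
    map (Int.castRingHom (ZMod p)) ((m : ℤ) • f) =
      (m : ZMod p) • map (Int.castRingHom (ZMod p)) f := by
  simp [smul_eq_C_mul]

theorem map_transfer (f : MvPolynomial (Fin n) ℤ) :
    map (Int.castRingHom (ZMod p)) (transfer ℤ n f) =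
      transfer (ZMod p) n (map (Int.castRingHom (ZMod p)) f) := by
  simp [transfer_apply, map_rename]

variable [Fact p.Prime]

/-- If `n! = p u` with `p ∤ u`, a polynomial killed by the transfer is congruent to a symmetric
one: the transfer of an integral lift `F` is `p G` with `G` symmetric, and `p G ≡ n! F = p u F`
modulo the relations, so `G ≡ u F` because the integral cofixed space is torsion-free. -/
theorem exists_sub_mem_of_transfer_eq_zero (hu : n.factorial = p * u) (hpu : ¬ p ∣ u)
    {f : MvPolynomial (Fin n) (ZMod p)} (hf : transfer (ZMod p) n f = 0) :
    ∃ r : ElemRing (ZMod p) n, f - algebraMap _ _ r ∈ cofixedRelations (ZMod p) n := by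
  have hp0 : (p : ℤ) ≠ 0 := by exact_mod_cast (Fact.out : p.Prime).ne_zero
  have hu0 : (u : ZMod p) ≠ 0 := by rwa [Ne, ZMod.natCast_eq_zero_iff]
  obtain ⟨F, rfl⟩ := map_surjective (Int.castRingHom (ZMod p)) ZMod.intCast_surjective f
  rw [← map_transfer] at hf
  obtain ⟨G, hG⟩ := exists_eq_smul_of_map_eq_zero hf
  have hGs : G.IsSymmetric := isSymmetric_of_smul hp0 (hG ▸ isSymmetric_transfer F)
  have h := transfer_sub_factorial_smul_mem F
  rw [hG, hu, Nat.cast_mul, mul_smul, ← smul_sub] at h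
  have h2 := map_mem_cofixedRelations (Int.castRingHom (ZMod p))
    (mem_cofixedRelations_of_smul_mem hp0 h)
  have hGs' : (map (Int.castRingHom (ZMod p)) G).IsSymmetric := hGs.map _
  obtain ⟨r, hr⟩ := exists_algebraMap_eq_of_isSymmetric (hGs'.smul ((u : ZMod p)⁻¹))
  refine ⟨r, ?_⟩
  have h3 := smul_mem_cofixedRelations (-(u : ZMod p)⁻¹) h2
  rw [hr]
  convert h3 using 1
  rw [map_sub, map_natCast_smul, smul_sub, smul_smul, neg_mul, inv_mul_cancel₀ hu0, neg_smul,
    neg_smul, one_smul]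
  abel

/-- If `n! = p u` with `p ∤ u`, a symmetric polynomial that vanishes in the cofixed space is a
transfer: it lifts to an integral symmetric polynomial that is `p F` modulo the integral relations,
and taking transfers and dividing by `p` shows that `u` times the lift is the transfer of `F`. -/
theorem exists_transfer_eq_of_algebraMap_mem (hu : n.factorial = p * u) (hpu : ¬ p ∣ u)
    {r : ElemRing (ZMod p) n} (hr : algebraMap _ _ r ∈ cofixedRelations (ZMod p) n) :
    ∃ f, transfer (ZMod p) n f = algebraMap _ _ r := by
  have hp0 : (p : ℤ) ≠ 0 := by exact_mod_cast (Fact.out : p.Prime).ne_zero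
  have hu0 : (u : ZMod p) ≠ 0 := by rwa [Ne, ZMod.natCast_eq_zero_iff]
  have hs : Function.Surjective (Int.castRingHom (ZMod p)) := ZMod.intCast_surjective
  obtain ⟨s, hs'⟩ := exists_map_algebraMap_eq hs r
  obtain ⟨g, hg, hg'⟩ := exists_map_eq_of_mem_cofixedRelations hs hr
  obtain ⟨F, hF⟩ := exists_eq_smul_of_map_eq_zero (p := p) (n := n)
    (f := algebraMap _ _ s - g) (by rw [map_sub, hs', hg', sub_self])
  have h := congrArg (transfer ℤ n) hF
  rw [map_sub, cofixedRelations_le_ker_transfer hg, sub_zero,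
    transfer_of_isSymmetric (rename_algebraMap s), transfer_smul, hu, Nat.cast_mul, mul_smul] at h
  have h2 := congrArg (map (Int.castRingHom (ZMod p))) (smul_right_injective _ hp0 h)
  refine ⟨(u : ZMod p)⁻¹ • map (Int.castRingHom (ZMod p)) F, ?_⟩
  rw [transfer_smul, ← map_transfer, ← h2, map_natCast_smul, hs', smul_smul, inv_mul_cancel₀ hu0,
    one_smul]

end Integral

/-! ### Generating polynomials of elementary symmetric functions -/

section GeneratingPolynomial

open Finset

variable {τ A : Type*} [CommRing A]

/-- The polynomial `∏_{x ∈ s} (1 + v(x) T)` in `T`, whose coefficients are the elementary symmetric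
functions of the family `v` on `s`. -/
noncomputable def esymmGen (v : τ → A) (s : Finset τ) : Polynomial A :=
  ∏ x ∈ s, (1 + Polynomial.C (v x) * Polynomial.X)

theorem coeff_esymmGen (v : τ → A) (s : Finset τ) (j : ℕ) :
    (esymmGen v s).coeff j = ∑ t ∈ powersetCard j s, ∏ x ∈ t, v x := by
  classical
  have h : ∀ t ∈ s.powerset, (∏ x ∈ t, Polynomial.C (v x) * Polynomial.X : Polynomial A).coeff j =
      if #t = j then ∏ x ∈ t, v x else 0 := by
    intro t _
    rw [prod_mul_distrib, prod_const, ← map_prod, Polynomial.coeff_C_mul_X_pow]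
    simp only [eq_comm]
  rw [esymmGen, prod_one_add, Polynomial.finsetSum_coeff, sum_congr rfl h, ← sum_filter,
    powersetCard_eq_filter]

theorem coeff_esymmGen_X (k : Type*) [CommRing k] (n j : ℕ) :
    (esymmGen X univ).coeff j = esymm (Fin n) k j := by
  rw [coeff_esymmGen, esymm]

theorem map_esymmGen {B : Type*} [CommRing B] (f : A →+* B) (v : τ → A) (s : Finset τ) :
    (esymmGen v s).map f = esymmGen (fun x => f (v x)) s := by
  simp [esymmGen, Polynomial.map_prod]

theorem coeff_zero_esymmGen (v : τ → A) (s : Finset τ) : (esymmGen v s).coeff 0 = 1 := by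
  simp [coeff_esymmGen]

theorem coeff_card_esymmGen (v : τ → A) (s : Finset τ) :
    (esymmGen v s).coeff #s = ∏ x ∈ s, v x := by
  simp [coeff_esymmGen]

theorem coeff_esymmGen_of_card_lt (v : τ → A) {s : Finset τ} {j : ℕ} (h : #s < j) :
    (esymmGen v s).coeff j = 0 := by
  simp [coeff_esymmGen, powersetCard_eq_empty.2 h]

/-- Compare coefficients in the derivative of the product defining `esymmGen v s`. -/
theorem succ_mul_coeff_esymmGen [DecidableEq τ] (v : τ → A) (s : Finset τ) (j : ℕ) :
    (j + 1 : A) * (esymmGen v s).coeff (j + 1) =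
      ∑ x ∈ s, v x * (esymmGen v (s.erase x)).coeff j := by
  have h := congrArg (fun q => Polynomial.coeff q j)
    (Polynomial.derivative_prod_finset (s := s)
      (f := fun x => (1 + Polynomial.C (v x) * Polynomial.X : Polynomial A)))
  simp only [Polynomial.finsetSum_coeff, Polynomial.coeff_derivative] at h
  rw [mul_comm, esymmGen, h]
  refine sum_congr rfl fun x _ => ?_
  simp only [Polynomial.derivative_add, Polynomial.derivative_one, Polynomial.derivative_mul,
    Polynomial.derivative_C, Polynomial.derivative_X, zero_mul, zero_add, mul_one,
    Polynomial.coeff_mul_C]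
  rw [mul_comm, esymmGen]

end GeneratingPolynomial

/-! ### The ideal annihilates the class of `1` -/

section Annihilator

open Finset

variable {k : Type*} [Field k] {p : ℕ} [CharP k p] {n : ℕ}

theorem rename_coeff_esymmGen (σ : Equiv.Perm (Fin n)) (s : Finset (Fin n)) (j : ℕ) :
    rename σ ((esymmGen (X : Fin n → MvPolynomial (Fin n) k) s).coeff j) =
      (esymmGen X (s.map σ.toEmbedding)).coeff j := by
  have h : (esymmGen (X : Fin n → MvPolynomial (Fin n) k) s).map (rename σ).toRingHom =
      esymmGen X (s.map σ.toEmbedding) := by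
    rw [map_esymmGen]
    simp [esymmGen, prod_map]
  rw [← h, Polynomial.coeff_map]
  rfl

theorem map_swap_of_mem {P : Finset (Fin n)} {x y : Fin n} (hx : x ∈ P) (hy : y ∈ P) :
    P.map (Equiv.swap x y).toEmbedding = P := by
  refine eq_of_subset_of_card_le (fun z hz => ?_) (by simp)
  obtain ⟨w, hw, rfl⟩ := mem_map.1 hz
  change Equiv.swap x y w ∈ P
  rw [Equiv.swap_apply_def]
  split_ifs <;> assumption

theorem map_swap_erase {P : Finset (Fin n)} {x y : Fin n} (hx : x ∈ P) (hy : y ∈ P) :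
    (P.erase x).map (Equiv.swap x y).toEmbedding = P.erase y := by
  rw [map_erase, map_swap_of_mem hx hy]
  simp

theorem map_swap_compl {P : Finset (Fin n)} {x y : Fin n} (hx : x ∈ P) (hy : y ∈ P) :
    (Pᶜ).map (Equiv.swap x y).toEmbedding = Pᶜ := by
  refine eq_of_subset_of_card_le (fun z hz => ?_) (by simp)
  obtain ⟨w, hw, rfl⟩ := mem_map.1 hz
  rw [mem_compl] at hw
  change Equiv.swap x y w ∈ Pᶜ
  rwa [Equiv.swap_apply_of_ne_of_ne (by rintro rfl; exact hw hx) (by rintro rfl; exact hw hy),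
    mem_compl]

/-- For a block `P` of `p` variables and `0 < a < p`, every multiple of `e_a(P)` by a polynomial
symmetric in `P` vanishes in the cofixed space: `a e_a(P)` is the sum over `x ∈ P` of
`x e_{a-1}(P ∖ {x})`, and these `p` summands all have the same class. -/
theorem coeff_esymmGen_mul_mem {P : Finset (Fin n)} (hP : #P = p) {a : ℕ} (ha : 0 < a)
    (hap : a < p) {h : MvPolynomial (Fin n) k}
    (hh : ∀ x ∈ P, ∀ y ∈ P, rename (Equiv.swap x y) h = h) :
    (esymmGen X P).coeff a * h ∈ cofixedRelations k n := by
  obtain ⟨a, rfl⟩ : ∃ b, a = b + 1 := ⟨a - 1, by omega⟩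
  have hp : 0 < #P := by omega
  obtain ⟨x₀, hx₀⟩ := card_pos.1 hp
  set t : Fin n → MvPolynomial (Fin n) k :=
    fun x => X x * (esymmGen X (P.erase x)).coeff a * h with ht
  have hsum : ((a + 1 : ℕ) : k) • ((esymmGen X P).coeff (a + 1) * h) =
      ∑ x ∈ P, (t x - t x₀) := by
    rw [sum_sub_distrib, sum_const, hP, nsmul_eq_mul, CharP.cast_eq_zero _ p, zero_mul, sub_zero,
      ht, ← sum_mul, ← succ_mul_coeff_esymmGen, smul_eq_C_mul, ← mul_assoc]
    simp
  have hmem : ((a + 1 : ℕ) : k) • ((esymmGen X P).coeff (a + 1) * h) ∈ cofixedRelations k n := by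
    rw [hsum]
    refine sum_mem fun x hx => ?_
    have hr : rename (Equiv.swap x x₀) (t x) = t x₀ := by
      simp only [ht]
      rw [map_mul, map_mul, rename_coeff_esymmGen, hh x hx x₀ hx₀, map_swap_erase hx hx₀, rename_X,
        Equiv.swap_apply_left]
    rw [← hr]
    exact sub_rename_mem _ _
  have ha0 : ((a + 1 : ℕ) : k) ≠ 0 := by
    rw [Ne, CharP.cast_eq_zero_iff k p]
    exact Nat.not_dvd_of_pos_of_lt ha hap
  have := smul_mem_cofixedRelations ((a + 1 : ℕ) : k)⁻¹ hmem
  rwa [smul_smul, inv_mul_cancel₀ ha0, one_smul] at this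

variable [Fact p.Prime]

/-- Modulo the relations, and against a factor symmetric in the block `P` of `p` variables, the
factor `∏_{x ∈ P} (1 + x T)` of the generating polynomial may be replaced by its two extreme
terms. -/
theorem esymm_mul_sub_mem {P : Finset (Fin n)} (hP : #P = p) (j : ℕ) {h : MvPolynomial (Fin n) k}
    (hh : ∀ x ∈ P, ∀ y ∈ P, rename (Equiv.swap x y) h = h) :
    esymm (Fin n) k j * h - Polynomial.coeff
      ((1 + Polynomial.C (∏ x ∈ P, X x : MvPolynomial (Fin n) k) * Polynomial.X ^ p) *
        esymmGen X Pᶜ) j * h ∈ cofixedRelations k n := by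
  have hp : 0 < p := (Fact.out : p.Prime).pos
  have hsplit : esymmGen (X : Fin n → MvPolynomial (Fin n) k) univ =
      esymmGen X P * esymmGen X Pᶜ := (prod_mul_prod_compl P _).symm
  rw [← coeff_esymmGen_X, ← sub_mul, ← Polynomial.coeff_sub, hsplit, ← sub_mul,
    Polynomial.coeff_mul, sum_mul]
  refine sum_mem fun ab _ => ?_
  rw [mul_assoc, Polynomial.coeff_sub, Polynomial.coeff_add, Polynomial.coeff_C_mul_X_pow,
    Polynomial.coeff_one]
  rcases Nat.eq_zero_or_pos ab.1 with h0 | h0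
  · rw [h0, coeff_zero_esymmGen]
    simp [hp.ne]
  rcases lt_trichotomy ab.1 p with h1 | h1 | h1
  · rw [if_neg (by omega), if_neg (by omega), add_zero, sub_zero]
    refine coeff_esymmGen_mul_mem hP h0 h1 fun x hx y hy => ?_
    rw [map_mul, hh x hx y hy, rename_coeff_esymmGen, map_swap_compl hx hy]
  · rw [h1, if_neg (by omega), if_pos rfl, zero_add, ← coeff_card_esymmGen X P, hP, sub_self,
      zero_mul]
    exact zero_mem _
  · rw [if_neg (by omega), if_neg (by omega), coeff_esymmGen_of_card_lt _ (by omega)]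
    simp

theorem coeff_one_add_C_mul_X_pow_mul {A : Type*} [CommRing A] (c : A) (q : ℕ) (f : Polynomial A)
    (j : ℕ) : ((1 + Polynomial.C c * Polynomial.X ^ q) * f).coeff j =
      f.coeff j + if q ≤ j then c * f.coeff (j - q) else 0 := by
  rw [add_mul, one_mul, Polynomial.coeff_add, mul_assoc, Polynomial.coeff_C_mul,
    Polynomial.coeff_X_pow_mul']
  simp

/-- The elements of the ideal vanish in the cofixed space. For a block `P` of `p` variables and
`1 ≤ j ≤ i`, both `e_j e_p` and `e_{p+j}` are congruent to `x_P e_j(Pᶜ)`, where `x_P` is the product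
of the block; for `i < j < p`, `e_j` is congruent to `e_j(Pᶜ) = 0`. -/
theorem algebraMap_mem_of_mem_idealJ {i : ℕ} (hi : i < p) (hn : n = p + i) {r : ElemRing k n}
    (hr : r ∈ idealJ k n p i) : algebraMap _ (MvPolynomial (Fin n) k) r ∈ cofixedRelations k n := by
  obtain ⟨P, -, hP⟩ := exists_subset_card_eq (s := (univ : Finset (Fin n))) (n := p)
    (by simp [hn])
  have hPc : #Pᶜ = i := by rw [card_compl, hP, Fintype.card_fin]; omega
  have hle : idealJ k n p i ≤ (cofixedRelations k n).comap
      (Algebra.linearMap (ElemRing k n) (MvPolynomial (Fin n) k)) := by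
    refine Submodule.span_le.2 ?_
    have hone : ∀ x ∈ P, ∀ y ∈ P, rename (Equiv.swap x y) (1 : MvPolynomial (Fin n) k) = 1 :=
      fun _ _ _ _ => map_one _
    rintro _ (⟨j, hj1, hji, rfl⟩ | ⟨j, hij, hjp, rfl⟩)
    · change algebraMap (ElemRing k n) _ _ ∈ cofixedRelations k n
      rw [map_sub, map_mul, algebraMap_e, algebraMap_e, algebraMap_e]
      have h1 := esymm_mul_sub_mem hP j (h := esymm (Fin n) k p)
        fun x _ y _ => esymm_isSymmetric (Fin n) k p _
      have h2 := esymm_mul_sub_mem hP p (h := (esymmGen (X : Fin n → MvPolynomial (Fin n) k)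
        Pᶜ).coeff j) fun x hx y hy => by rw [rename_coeff_esymmGen, map_swap_compl hx hy]
      have h3 := esymm_mul_sub_mem hP (p + j) hone
      rw [coeff_one_add_C_mul_X_pow_mul, if_neg (by omega)] at h1
      rw [coeff_one_add_C_mul_X_pow_mul, if_pos le_rfl, Nat.sub_self, coeff_zero_esymmGen,
        coeff_esymmGen_of_card_lt (s := Pᶜ) (j := p) _ (by omega)] at h2
      rw [coeff_one_add_C_mul_X_pow_mul, if_pos (by omega), Nat.add_sub_cancel_left,
        coeff_esymmGen_of_card_lt (s := Pᶜ) (j := p + j) _ (by omega)] at h3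
      -- First reduce `e_j` against the factor `e_p`, then `e_p` against the factor `e_j(Pᶜ)`.
      convert sub_mem (add_mem h1 h2) h3 using 1
      ring
    · change algebraMap (ElemRing k n) _ _ ∈ cofixedRelations k n
      have h := esymm_mul_sub_mem hP j hone
      rw [coeff_one_add_C_mul_X_pow_mul, if_neg (by omega),
        coeff_esymmGen_of_card_lt _ (by omega)] at h
      simpa using h
  exact hle hr

end Annihilator

/-! ### Restriction to the locus where `p` variables agree -/

section Restriction

open Finset

variable {k : Type*} [Field k] {n i : ℕ}

/-- The point at which the variables outside the range of `ι` take a common value, the variable of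
the outer polynomial ring, and the variable `ι j` takes the value `y_j`. -/
noncomputable def blockPoint (k : Type*) [Field k] (ι : Fin i ↪ Fin n) (x : Fin n) :
    Polynomial (MvPolynomial (Fin i) k) :=
  (Function.partialInv ι x).elim Polynomial.X fun j => Polynomial.C (X j)

theorem blockPoint_apply (ι : Fin i ↪ Fin n) (j : Fin i) :
    blockPoint k ι (ι j) = Polynomial.C (X j) := by
  rw [blockPoint, (Function.Injective.isPartialInv ι.injective).eq]
  rfl

theorem blockPoint_of_notMem {ι : Fin i ↪ Fin n} {x : Fin n} (hx : ¬∃ j, ι j = x) :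
    blockPoint k ι x = Polynomial.X := by
  rw [blockPoint, Function.partialInv, dif_neg hx]
  rfl

/-- Evaluation of polynomials in `n` variables at `blockPoint k ι`. -/
noncomputable def restrict (k : Type*) [Field k] (ι : Fin i ↪ Fin n) :
    MvPolynomial (Fin n) k →ₐ[k] Polynomial (MvPolynomial (Fin i) k) :=
  aeval (blockPoint k ι)

theorem restrict_rename (ι : Fin i ↪ Fin n) (σ : Equiv.Perm (Fin n)) (f : MvPolynomial (Fin n) k) :
    restrict k ι (rename σ f) = restrict k (ι.trans σ.symm.toEmbedding) f := by
  rw [restrict, aeval_rename, restrict]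
  congr 2
  ext1 x
  by_cases hx : ∃ j, ι j = σ x
  · obtain ⟨j, hj⟩ := hx
    have hj' : x = (ι.trans σ.symm.toEmbedding) j := by simp [hj]
    rw [Function.comp_apply, ← hj, blockPoint_apply, hj', blockPoint_apply]
  · rw [Function.comp_apply, blockPoint_of_notMem hx, blockPoint_of_notMem]
    rintro ⟨j, rfl⟩
    exact hx ⟨j, by simp⟩

theorem map_rename_restrict (ι : Fin i ↪ Fin n) (σ : Equiv.Perm (Fin i))
    (f : MvPolynomial (Fin n) k) :
    (restrict k ι f).map (rename σ).toRingHom =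
      restrict k (σ.symm.toEmbedding.trans ι) f := by
  have h : ((Polynomial.mapRingHom (rename (R := k) σ).toRingHom).comp (restrict k ι).toRingHom) =
      (restrict k (σ.symm.toEmbedding.trans ι)).toRingHom := by
    refine MvPolynomial.ringHom_ext (fun c => ?_) fun x => ?_
    · simp [restrict, MvPolynomial.algebraMap_eq]
    · by_cases hx : ∃ j, ι j = x
      · obtain ⟨j, rfl⟩ := hx
        have hj : ι j = (σ.symm.toEmbedding.trans ι) (σ j) := by simp
        have h2 : blockPoint k (σ.symm.toEmbedding.trans ι) (ι j) = Polynomial.C (X (σ j)) := by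
          rw [hj, blockPoint_apply]
        simp [restrict, blockPoint_apply, h2]
      · have h2 : blockPoint k (σ.symm.toEmbedding.trans ι) x = Polynomial.X :=
          blockPoint_of_notMem fun ⟨j, hj⟩ => hx ⟨σ.symm j, hj⟩
        simp [restrict, blockPoint_of_notMem hx, h2]
  exact congrArg (fun g => g f) h

variable {p : ℕ}

theorem esymmGen_blockPoint (hn : n = p + i) (ι : Fin i ↪ Fin n) :
    esymmGen (blockPoint k ι) univ =
      (1 + Polynomial.C (Polynomial.X : Polynomial (MvPolynomial (Fin i) k)) * Polynomial.X) ^ p *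
        esymmGen (fun j : Fin i => Polynomial.C (X j : MvPolynomial (Fin i) k)) univ := by
  have h1 : ∏ x ∈ (univ.map ι)ᶜ, (1 + Polynomial.C (blockPoint k ι x) * Polynomial.X) =
      (1 + Polynomial.C (Polynomial.X : Polynomial (MvPolynomial (Fin i) k)) *
        Polynomial.X) ^ p := by
    have hcard : #(univ.map ι)ᶜ = p := by simp [card_compl, hn]
    rw [← hcard]
    refine prod_eq_pow_card fun x hx => ?_
    rw [blockPoint_of_notMem (by simpa using hx)]
  have h2 : ∏ x ∈ univ.map ι, (1 + Polynomial.C (blockPoint k ι x) * Polynomial.X) =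
      esymmGen (fun j : Fin i => Polynomial.C (X j : MvPolynomial (Fin i) k)) univ := by
    rw [prod_map, esymmGen]
    exact prod_congr rfl fun j _ => by rw [blockPoint_apply]
  rw [← h1, ← h2]
  exact (prod_compl_mul_prod _ _).symm

theorem one_add_C_mul_X_pow_char {A : Type*} [CommRing A] [Fact p.Prime] [CharP A p] (a : A) :
    (1 + Polynomial.C a * Polynomial.X) ^ p =
      1 + Polynomial.C (a ^ p) * Polynomial.X ^ p := by
  rw [add_pow_char, one_pow, mul_pow, Polynomial.C_pow]

variable [Fact p.Prime] [CharP k p]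

/-- The restriction of `e_j`. The variables of the block contribute
`(1 + a T) ^ p = 1 + a ^ p T ^ p` to the generating polynomial, so only `p`-th powers of their common value `a` occur. -/
theorem restrict_esymm (hn : n = p + i) (ι : Fin i ↪ Fin n) (j : ℕ) :
    restrict k ι (esymm (Fin n) k j) = Polynomial.expand _ p
      (Polynomial.C (esymm (Fin i) k j) +
        if p ≤ j then Polynomial.X * Polynomial.C (esymm (Fin i) k (j - p)) else 0) := by
  have hC : ∀ l, (esymmGen (fun j : Fin i => (Polynomial.C (X j : MvPolynomial (Fin i) k)))
      univ).coeff l = Polynomial.C (esymm (Fin i) k l) := fun l => by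
    rw [← coeff_esymmGen_X, ← Polynomial.coeff_map, map_esymmGen]
  have h : restrict k ι (esymm (Fin n) k j) = (esymmGen (blockPoint k ι) univ).coeff j := by
    have h2 : (esymmGen (X : Fin n → MvPolynomial (Fin n) k) univ).map (restrict k ι).toRingHom =
        esymmGen (blockPoint k ι) univ := by
      rw [map_esymmGen]
      simp [restrict]
    rw [← h2, Polynomial.coeff_map, coeff_esymmGen_X]
    rfl
  rw [h, esymmGen_blockPoint hn, one_add_C_mul_X_pow_char,
    coeff_one_add_C_mul_X_pow_mul, hC, hC, map_add, Polynomial.expand_C]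
  split_ifs <;> simp

theorem esymm_eq_zero_of_lt {j : ℕ} (h : i < j) : esymm (Fin i) k j = 0 := by
  rw [esymm, powersetCard_eq_empty.2 (by simpa using h), sum_empty]

/-- The ring homomorphism `k[w₁, …, wᵢ][z] → k[e₁, …, eₙ]` sending `w_j` to `e_j` and `z` to
`e_p`. -/
noncomputable def polyToElem (k : Type*) [Field k] (n p i : ℕ) :
    Polynomial (MvPolynomial (Fin i) k) →+* ElemRing k n :=
  Polynomial.eval₂RingHom (aeval fun j : Fin i => e k n (j + 1)).toRingHom (e k n p)

/-- The endomorphism of `k[w₁, …, wᵢ]` substituting the elementary symmetric polynomials for the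
variables. -/
noncomputable def esymmSubst (k : Type*) [Field k] (i : ℕ) :
    MvPolynomial (Fin i) k →+* MvPolynomial (Fin i) k :=
  (aeval fun j : Fin i => esymm (Fin i) k (j + 1)).toRingHom

theorem esymmSubst_eq (q : MvPolynomial (Fin i) k) :
    esymmSubst k i q = (esymmAlgHom (Fin i) k i q : MvPolynomial (Fin i) k) :=
  (esymmAlgHom_apply _).symm

theorem esymmSubst_injective : Function.Injective (esymmSubst k i) := by
  intro a b h
  rw [esymmSubst_eq, esymmSubst_eq] at h
  exact esymmAlgHom_injective k (by simp) (Subtype.val_injective h)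

theorem mem_range_esymmSubst {f : MvPolynomial (Fin i) k} (hf : f.IsSymmetric) :
    f ∈ (esymmSubst k i).range := by
  obtain ⟨q, hq⟩ := esymmAlgHom_surjective k (σ := Fin i) (n := i) (by simp) ⟨f, hf⟩
  exact ⟨q, by rw [esymmSubst_eq, hq]⟩

theorem restrict_polyToElem (hi : i < p) (hn : n = p + i) (ι : Fin i ↪ Fin n)
    (q : Polynomial (MvPolynomial (Fin i) k)) :
    restrict k ι (algebraMap _ _ (polyToElem k n p i q)) =
      Polynomial.expand _ p (q.map (esymmSubst k i)) := by
  have h : (((restrict k ι).toRingHom.comp (algebraMap (ElemRing k n) _)).comp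
      (polyToElem k n p i)) = ((Polynomial.expand (MvPolynomial (Fin i) k) p).toRingHom.comp
        (Polynomial.mapRingHom (esymmSubst k i))) := by
    refine Polynomial.ringHom_ext' (MvPolynomial.ringHom_ext (fun c => ?_) fun j => ?_) ?_
    · simp [polyToElem, esymmSubst, restrict, MvPolynomial.algebraMap_eq]
    · have hj : ¬p ≤ (j : ℕ) + 1 := by have := j.2; omega
      simp [polyToElem, esymmSubst, restrict_esymm hn, hj]
    · simp [polyToElem, restrict_esymm hn, esymm_eq_zero_of_lt hi]
  exact congrArg (fun g => g q) h

/-- Modulo `J`, the ring `k[e₁, …, eₙ]` is generated by `e₁, …, eᵢ` and `e_p`. -/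
theorem exists_sub_polyToElem_mem (hn : n = p + i) (r : ElemRing k n) :
    ∃ q, r - polyToElem k n p i q ∈ idealJ k n p i := by
  induction r using ElemRing.induction with
  | hC c => exact ⟨Polynomial.C (C c), by simp [polyToElem, MvPolynomial.algHom_C]⟩
  | he j =>
    have hlow : ∀ j, 1 ≤ j → j ≤ i → ∃ w, polyToElem k n p i (Polynomial.C w) = e k n j := by
      intro j h1 h2
      exact ⟨X ⟨j - 1, by omega⟩, by simp [polyToElem, Nat.sub_add_cancel h1]⟩
    have hp : polyToElem k n p i Polynomial.X = e k n p := by simp [polyToElem]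
    rcases Nat.eq_zero_or_pos j with rfl | h0
    · refine ⟨1, ?_⟩
      have h1 : e k n 0 = 1 := algebraMap_injective (by simp)
      rw [map_one, h1, sub_self]
      exact zero_mem _
    rcases le_or_gt j i with h1 | h1
    · obtain ⟨w, hw⟩ := hlow j h0 h1
      exact ⟨Polynomial.C w, by rw [hw, sub_self]; exact zero_mem _⟩
    rcases lt_trichotomy j p with h2 | rfl | h2
    · refine ⟨0, ?_⟩
      rw [map_zero, sub_zero]
      exact Ideal.subset_span (Or.inr ⟨j, h1, h2, rfl⟩)
    · exact ⟨Polynomial.X, by rw [hp, sub_self]; exact zero_mem _⟩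
    rcases le_or_gt j n with h3 | h3
    · obtain ⟨l, rfl⟩ : ∃ l, j = p + l := ⟨j - p, by omega⟩
      obtain ⟨w, hw⟩ := hlow l (by omega) (by omega)
      refine ⟨Polynomial.C w * Polynomial.X, ?_⟩
      rw [map_mul, hw, hp, ← neg_sub]
      exact neg_mem (Ideal.subset_span (Or.inl ⟨l, by omega, by omega, rfl⟩))
    · refine ⟨0, ?_⟩
      have h4 : e k n j = 0 := algebraMap_injective (by
        rw [algebraMap_e, map_zero, esymm_eq_zero_of_lt h3])
      rw [h4, map_zero, sub_zero]
      exact zero_mem _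
  | hadd r s hr hs =>
    obtain ⟨a, ha⟩ := hr
    obtain ⟨b, hb⟩ := hs
    exact ⟨a + b, by rw [map_add, add_sub_add_comm]; exact add_mem ha hb⟩
  | hmul r s hr hs =>
    obtain ⟨a, ha⟩ := hr
    obtain ⟨b, hb⟩ := hs
    refine ⟨a * b, ?_⟩
    have h : r * s - polyToElem k n p i (a * b) =
        r * (s - polyToElem k n p i b) + (r - polyToElem k n p i a) * polyToElem k n p i b := by
      rw [map_mul]
      ring
    rw [h]
    exact add_mem (Ideal.mul_mem_left _ _ hb) (Ideal.mul_mem_right _ _ ha)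

end Restriction

/-! ### The retraction of the cofixed space -/

section Average

open Finset

variable {k : Type*} [Field k] {n i p : ℕ}

/-- The sum of the restrictions over all ways of placing the `i` free variables. It plays the role
of `1 / p!` times the transfer: its value at `1` is `n! / p!`, which is prime to `p`. -/
noncomputable def blockSum (k : Type*) [Field k] (n i : ℕ) :
    MvPolynomial (Fin n) k →ₗ[k] Polynomial (MvPolynomial (Fin i) k) :=
  ∑ ι : Fin i ↪ Fin n, (restrict k ι).toLinearMap

theorem blockSum_apply (f : MvPolynomial (Fin n) k) :
    blockSum k n i f = ∑ ι : Fin i ↪ Fin n, restrict k ι f := by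
  simp [blockSum]

theorem blockSum_rename (σ : Equiv.Perm (Fin n)) (f : MvPolynomial (Fin n) k) :
    blockSum k n i (rename σ f) = blockSum k n i f := by
  rw [blockSum_apply, blockSum_apply]
  refine Fintype.sum_equiv (Equiv.embeddingCongr (Equiv.refl _) σ.symm) _ _ fun ι => ?_
  rw [restrict_rename]
  rfl

theorem blockSum_eq_zero_of_mem {f : MvPolynomial (Fin n) k} (hf : f ∈ cofixedRelations k n) :
    blockSum k n i f = 0 := by
  induction hf using cofixedRelations_induction with
  | hsub f σ => rw [map_sub, blockSum_rename, sub_self]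
  | hzero => exact map_zero _
  | hadd f g _ _ hf hg => rw [map_add, hf, hg, add_zero]
  | hsmul c f _ hf => rw [map_smul, hf, smul_zero]

theorem isSymmetric_coeff_blockSum (f : MvPolynomial (Fin n) k) (m : ℕ) :
    ((blockSum k n i f).coeff m).IsSymmetric := by
  intro σ
  have h : (blockSum k n i f).map (rename σ).toRingHom = blockSum k n i f := by
    rw [blockSum_apply, Polynomial.map_sum]
    refine Fintype.sum_equiv (Equiv.embeddingCongr σ (Equiv.refl _)) _ _ fun ι => ?_
    rw [map_rename_restrict]
    rfl
  conv_rhs => rw [← h, Polynomial.coeff_map]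
  rfl

variable [Fact p.Prime]

/-- The part of `blockSum` in which the exponent of the block variable is divisible by `p`, with
those exponents divided by `p`. -/
noncomputable def contractSum (k : Type*) [Field k] (n p i : ℕ) [hp : Fact p.Prime] :
    MvPolynomial (Fin n) k →+ Polynomial (MvPolynomial (Fin i) k) where
  toFun f := Polynomial.contract p (blockSum k n i f)
  map_zero' := by rw [map_zero, ← Polynomial.C_0, Polynomial.contract_C]
  map_add' f g := by rw [map_add, Polynomial.contract_add hp.out.ne_zero]

theorem contractSum_apply (f : MvPolynomial (Fin n) k) :
    contractSum k n p i f = Polynomial.contract p (blockSum k n i f) :=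
  rfl

theorem contractSum_eq_zero_of_mem {f : MvPolynomial (Fin n) k}
    (hf : f ∈ cofixedRelations k n) : contractSum k n p i f = 0 := by
  rw [contractSum_apply, blockSum_eq_zero_of_mem hf, ← Polynomial.C_0, Polynomial.contract_C]

theorem not_dvd_descFactorial (hi : i < p) (hn : n = p + i) : ¬p ∣ n.descFactorial i := by
  rw [Nat.descFactorial_eq_prod_range, (Fact.out : p.Prime).prime.dvd_finsetProd_iff]
  rintro ⟨l, hl, h⟩
  rw [mem_range] at hl
  have h2 : n - l = p + (i - l) := by omega
  rw [h2, Nat.dvd_add_right dvd_rfl] at h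
  exact Nat.not_dvd_of_pos_of_lt (by omega) (by omega) h

variable [CharP k p]

/-- The restriction of a symmetric polynomial does not depend on the block, and is a polynomial in
the `p`-th power of the common value of the variables of the block. -/
theorem exists_restrict_eq_expand (hn : n = p + i) (r : ElemRing k n) :
    ∃ g, ∀ ι : Fin i ↪ Fin n, restrict k ι (algebraMap _ _ r) = Polynomial.expand _ p g := by
  induction r using ElemRing.induction with
  | hC c => exact ⟨Polynomial.C (C c), fun ι => by simp [restrict, MvPolynomial.algebraMap_eq]⟩
  | he j => exact ⟨_, fun ι => restrict_esymm hn ι j⟩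
  | hadd r s hr hs =>
    obtain ⟨a, ha⟩ := hr
    obtain ⟨b, hb⟩ := hs
    exact ⟨a + b, fun ι => by simp only [map_add, ha, hb]⟩
  | hmul r s hr hs =>
    obtain ⟨a, ha⟩ := hr
    obtain ⟨b, hb⟩ := hs
    exact ⟨a * b, fun ι => by simp only [map_mul, ha, hb]⟩

theorem contractSum_smul_eq_zero (hn : n = p + i) (r : ElemRing k n) {f : MvPolynomial (Fin n) k}
    (hf : contractSum k n p i f = 0) : contractSum k n p i (r • f) = 0 := by
  obtain ⟨g, hg⟩ := exists_restrict_eq_expand hn r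
  have h : blockSum k n i (r • f) = blockSum k n i f * Polynomial.expand _ p g := by
    rw [blockSum_apply, blockSum_apply, sum_mul]
    refine sum_congr rfl fun ι _ => ?_
    rw [Algebra.smul_def, map_mul, hg, mul_comm]
  rw [contractSum_apply, h, Polynomial.contract_mul_expand (Fact.out : p.Prime).ne_zero]
  rw [contractSum_apply] at hf
  rw [hf, zero_mul]

theorem contractSum_polyToElem (hi : i < p) (hn : n = p + i)
    (q : Polynomial (MvPolynomial (Fin i) k)) :
    contractSum k n p i (algebraMap _ _ (polyToElem k n p i q)) =
      (n.descFactorial i : Polynomial (MvPolynomial (Fin i) k)) * q.map (esymmSubst k i) := by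
  have h : blockSum k n i (algebraMap _ _ (polyToElem k n p i q)) =
      Polynomial.expand _ p ((n.descFactorial i : Polynomial (MvPolynomial (Fin i) k)) *
        q.map (esymmSubst k i)) := by
    rw [blockSum_apply, sum_congr rfl fun ι _ => restrict_polyToElem hi hn ι q, sum_const,
      card_univ, Fintype.card_embedding_eq, Fintype.card_fin, Fintype.card_fin, nsmul_eq_mul,
      map_mul, map_natCast]
  rw [contractSum_apply, h, Polynomial.contract_expand _ (Fact.out : p.Prime).ne_zero]

/-- A symmetric polynomial killed by `contractSum` lies in `J`: modulo `J` it is a polynomial in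
`e₁, …, eᵢ, e_p`, and the restrictions of these are algebraically independent. -/
theorem mem_idealJ_of_contractSum_eq_zero (hi : i < p) (hn : n = p + i) {r : ElemRing k n}
    (hr : contractSum k n p i (algebraMap _ _ r) = 0) : r ∈ idealJ k n p i := by
  obtain ⟨q, hq⟩ := exists_sub_polyToElem_mem hn r
  have hD : (n.descFactorial i : Polynomial (MvPolynomial (Fin i) k)) ≠ 0 := by
    rw [Ne, CharP.cast_eq_zero_iff _ p]
    exact not_dvd_descFactorial hi hn
  have h1 := contractSum_eq_zero_of_mem (p := p) (i := i) (algebraMap_mem_of_mem_idealJ hi hn hq)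
  rw [map_sub, map_sub, hr, zero_sub, neg_eq_zero, contractSum_polyToElem hi hn] at h1
  have h3 := (mul_eq_zero.1 h1).resolve_left hD
  have h4 : q = 0 := Polynomial.map_injective _ esymmSubst_injective
    (h3.trans (Polynomial.map_zero _).symm)
  rwa [h4, map_zero, sub_zero] at hq

/-- Every value of `contractSum` is attained on a symmetric polynomial, since its coefficients are
symmetric in the `i` free variables. -/
theorem exists_contractSum_sub_eq_zero (hi : i < p) (hn : n = p + i) (f : MvPolynomial (Fin n) k) :
    ∃ r : ElemRing k n, contractSum k n p i (f - algebraMap _ _ r) = 0 := by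
  have hD : (n.descFactorial i : k) ≠ 0 := by
    rw [Ne, CharP.cast_eq_zero_iff _ p]
    exact not_dvd_descFactorial hi hn
  have hmem : contractSum k n p i f ∈ (Polynomial.mapRingHom (esymmSubst k i)).range := by
    rw [Polynomial.mem_map_range]
    intro m
    rw [contractSum_apply, Polynomial.coeff_contract (Fact.out : p.Prime).ne_zero]
    exact mem_range_esymmSubst (isSymmetric_coeff_blockSum f _)
  obtain ⟨q, hq⟩ := hmem
  have hinv : (n.descFactorial i : Polynomial (MvPolynomial (Fin i) k)) *
      Polynomial.C (C (n.descFactorial i : k)⁻¹) = 1 := by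
    rw [← map_natCast (Polynomial.C.comp C : k →+* Polynomial (MvPolynomial (Fin i) k)),
      RingHom.comp_apply, ← Polynomial.C_mul, ← C_mul, mul_inv_cancel₀ hD, C_1, Polynomial.C_1]
  refine ⟨polyToElem k n p i (Polynomial.C (C (n.descFactorial i : k)⁻¹) * q), ?_⟩
  have hC : esymmSubst k i (C (n.descFactorial i : k)⁻¹) = C (n.descFactorial i : k)⁻¹ := by
    simp [esymmSubst, MvPolynomial.algebraMap_eq]
  rw [map_sub, contractSum_polyToElem hi hn, Polynomial.map_mul, Polynomial.map_C, hC,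
    ← mul_assoc, hinv, one_mul, ← hq]
  exact sub_self _

end Average

/-! ### The splitting -/

section Splitting

/-- A module that is the internal direct sum of the cyclic submodule `range α` and a complement,
where `range α` is also the kernel of a map `τ` whose image is a copy of the annihilator of the
cyclic submodule. -/
theorem nonempty_linearEquiv_quotient_prod {R M A : Type*} [CommRing R] [AddCommGroup M]
    [Module R M] [AddCommGroup A] [Module R A] {J : Ideal R} {α : R →ₗ[R] M} {τ : M →ₗ[R] A}
    {β : R →ₗ[R] A} (hβ : Function.Injective β) (hα : LinearMap.ker α = J)
    (hτ : LinearMap.range τ = Submodule.map β J) (hατ : LinearMap.ker τ = LinearMap.range α)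
    {N : Submodule R M} (hN : IsCompl (LinearMap.range α) N) : Nonempty (M ≃ₗ[R] (R ⧸ J) × J) := by
  have e₁ : LinearMap.range α ≃ₗ[R] R ⧸ J :=
    α.quotKerEquivRange.symm.trans (Submodule.quotEquivOfEq _ _ hα)
  have e₂ : N ≃ₗ[R] J :=
    (Submodule.quotientEquivOfIsCompl _ _ hN).symm.trans <|
      (Submodule.quotEquivOfEq _ _ hατ.symm).trans <| τ.quotKerEquivRange.trans <|
        (LinearEquiv.ofEq _ _ hτ).trans (Submodule.equivMapOfInjective β hβ J).symm
  exact ⟨(Submodule.prodEquivOfIsCompl _ _ hN).symm.trans (e₁.prodCongr e₂)⟩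

variable {p : ℕ} [Fact p.Prime] {n i : ℕ}

theorem exists_factorial_eq_mul (hi : i < p) (hn : n = p + i) :
    ∃ u, n.factorial = p * u ∧ ¬p ∣ u := by
  have hp : p.Prime := Fact.out
  refine ⟨(p - 1).factorial * n.descFactorial i, ?_, fun h => ?_⟩
  · rw [← mul_assoc, Nat.mul_factorial_pred hp.ne_zero,
      ← Nat.factorial_mul_descFactorial (show i ≤ n by omega)]
    congr 2
    omega
  · rcases hp.dvd_mul.1 h with h | h
    · have := (hp.dvd_factorial).1 h
      have := hp.pos
      omega
    · exact not_dvd_descFactorial hi hn h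

/-- The polynomials killed by `contractSum`, as a `k[e₁, …, eₙ]`-submodule. -/
noncomputable def contractKer (k : Type*) [Field k] [CharP k p] (hn : n = p + i) :
    Submodule (ElemRing k n) (MvPolynomial (Fin n) k) where
  carrier := {f | contractSum k n p i f = 0}
  add_mem' {a b} (ha : contractSum k n p i a = 0) (hb : contractSum k n p i b = 0) := by
    change contractSum k n p i (a + b) = 0
    rw [map_add, ha, hb, add_zero]
  zero_mem' := map_zero _
  smul_mem' r _ hf := contractSum_smul_eq_zero hn r hf

end Splitting

end SymmetricCofixed

open SymmetricCofixed in
theorem theorem5p1 (p : ℕ) (hp : p.Prime) (n i : ℕ) (hi : i < p) (hn : n = p + i) :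
    Nonempty
      (CofixedSpace (ZMod p) n ≃ₗ[ElemRing (ZMod p) n]
        (ElemRing (ZMod p) n ⧸ idealJ (ZMod p) n p i) × idealJ (ZMod p) n p i) := by
  have : Fact p.Prime := ⟨hp⟩
  obtain ⟨u, hu, hpu⟩ := exists_factorial_eq_mul hi hn
  have hn0 : (n.factorial : ZMod p) = 0 := by simp [hu]
  let C := cofixedRelations (ZMod p) n
  let β := Algebra.linearMap (ElemRing (ZMod p) n) (MvPolynomial (Fin n) (ZMod p))
  let τ := C.liftQ (transfer (ZMod p) n) cofixedRelations_le_ker_transfer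
  have hJ : ∀ r, β r ∈ C ↔ r ∈ idealJ (ZMod p) n p i := fun r =>
    ⟨fun h => mem_idealJ_of_contractSum_eq_zero hi hn (contractSum_eq_zero_of_mem h),
      algebraMap_mem_of_mem_idealJ hi hn⟩
  refine nonempty_linearEquiv_quotient_prod (α := C.mkQ.comp β) (τ := τ) (β := β)
    (N := (contractKer (ZMod p) hn).map C.mkQ) algebraMap_injective ?_ ?_ ?_ ?_
  · ext r
    rw [LinearMap.mem_ker, LinearMap.comp_apply, Submodule.mkQ_apply,
      Submodule.Quotient.mk_eq_zero, hJ]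
  · rw [Submodule.range_liftQ]
    ext f
    constructor
    · rintro ⟨f, rfl⟩
      obtain ⟨r, hr⟩ := exists_algebraMap_eq_of_isSymmetric (isSymmetric_transfer f)
      refine ⟨r, (hJ r).1 ?_, hr⟩
      have h := transfer_sub_factorial_smul_mem f
      rwa [hn0, zero_smul, sub_zero, ← hr] at h
    · rintro ⟨r, hr, rfl⟩
      exact exists_transfer_eq_of_algebraMap_mem hu hpu ((hJ r).2 hr)
  · ext m
    obtain ⟨f, rfl⟩ := C.mkQ_surjective m
    constructor
    · intro hf
      obtain ⟨r, hr⟩ := exists_sub_mem_of_transfer_eq_zero hu hpu (f := f) hf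
      exact ⟨r, ((Submodule.Quotient.eq C).2 hr).symm⟩
    · rintro ⟨r, hr⟩
      rw [← hr]
      change transfer (ZMod p) n (algebraMap _ _ r) = 0
      rw [transfer_of_isSymmetric (rename_algebraMap r), hn0, zero_smul]
  · constructor
    · rw [Submodule.disjoint_def]
      rintro _ ⟨r, rfl⟩ ⟨f, hf, hfr⟩
      have h : f - β r ∈ C := (Submodule.Quotient.eq C).1 hfr
      have h2 := contractSum_eq_zero_of_mem (p := p) (i := i) h
      change contractSum (ZMod p) n p i f = 0 at hf
      rw [map_sub, hf, zero_sub, neg_eq_zero] at h2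
      exact (Submodule.Quotient.mk_eq_zero C).2
        ((hJ r).2 (mem_idealJ_of_contractSum_eq_zero hi hn h2))
    · rw [codisjoint_iff, Submodule.eq_top_iff']
      intro m
      obtain ⟨f, rfl⟩ := C.mkQ_surjective m
      obtain ⟨r, hr⟩ := exists_contractSum_sub_eq_zero hi hn f
      exact Submodule.mem_sup.2 ⟨_, ⟨r, rfl⟩, _, ⟨f - β r, hr, rfl⟩,
        by rw [LinearMap.comp_apply, ← map_add, add_sub_cancel]⟩
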